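/- Lemma 2.8. Let $R$ be a commutative Noetherian ring with identity, $\mathfrak a$ an ideal of $R$, $M$ a finitely generated $R$-module whose projective dimension $d=\operatorname{pd}(M)$ is finite, and $N$ an arbitrary $R$-module. For an $R$-module $L$ and an ideal $\mathfrak b$ of $R$, put $$H^i_{\mathfrak b}(L)=\varinjlim_t\operatorname{Ext}^i_R(R/\mathfrak b^t,L),\qquad H^i_{\mathfrak b}(M,L)=\varinjlim_t\operatorname{Ext}^i_R(M/\mathfrak b^tM,L)\qquad(i\ge 0).$$ Let $n\ge 0$ be an integer and let $x_1,\dots,x_n$ be an $\mathfrak a$-filter regular sequence on $N$, that is, a sequence of elements of $\mathfrak a$ such that $$\operatorname{Supp}_R\Bigl(\bigl((x_1,\dots,x_{i-1})N:_N x_i\bigr)/(x_1,\dots,x_{i-1})N\Bigr)\subseteq V(\mathfrak a)\qquad\text{for all } i=1,\dots,n,$$ where $V(\mathfrak a)$ is the set of prime ideals of $R$ containing $\mathfrak a$. Then there is an isomorphism of $R$-modules $$H^{i+n}_{\mathfrak a}(M,N)\cong H^i_{\mathfrak a}\bigl(M,H^n_{(x_1,\dots,x_n)}(N)\bigr)$$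 for all integers $i\ge 0$ with $i\ge d$. (For $M=0$ we set $d=-\infty$, so that this covers all $i\ge 0$.) -/

import Mathlib

open CategoryTheory Limits Opposite

universe u

noncomputable section

/-- The inverse system `⋯ → M / 𝔞²M → M / 𝔞M → M / 𝔞⁰M` of quotients of the module `M` by the
submodules `𝔞ᵗM`, with the natural projections as transition maps. -/
def powQuotient {R : Type u} [CommRing R] (𝔞 : Ideal R) (M : ModuleCat.{u} R) :
    ℕᵒᵖ ⥤ ModuleCat.{u} R where
  obj t := ModuleCat.of R (M ⧸ (𝔞 ^ unop t • (⊤ : Submodule R M)))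
  map w := ModuleCat.ofHom <| Submodule.mapQ _ _ LinearMap.id
    (Submodule.smul_mono_left (Ideal.pow_le_pow_right w.unop.down.down))
  map_id t := by
    ext x
    rfl
  map_comp f g := by
    ext x
    rfl

/-- The generalized local cohomology functor `N ↦ Hⁱ_𝔞(M, N) = colim_t Extⁱ_R(M / 𝔞ᵗM, N)`,
with values in `R`-modules. (The usual local cohomology functors `Hⁱ_𝔞(N)`, the direct limits of
`Extⁱ_R(R / 𝔞ᵗ, N)`, are Mathlib's `localCohomology 𝔞 i`.) -/
def genLocalCohomology {R : Type u} [CommRing R] (𝔞 : Ideal R) (M : ModuleCat.{u} R) (i : ℕ) :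
    ModuleCat.{u} R ⥤ ModuleCat.{u} R :=
  colimit ((powQuotient 𝔞 M).op ⋙ Ext R (ModuleCat.{u} R) i)

/-- The submodule `L :_N r = {y ∈ N | r y ∈ L}` of `N`, for a submodule `L` of `N` and `r ∈ R`. -/
def colonElem {R : Type u} [CommRing R] {N : Type u} [AddCommGroup N] [Module R N]
    (L : Submodule R N) (r : R) : Submodule R N :=
  L.comap (LinearMap.lsmul R N r)

/-- For a sequence `x` of elements of `R`, the submodule of `N` generated by the multiples of
elements of `N` by the terms of `x` strictly before the term with index `i`. -/
def initialSubmodule {R : Type u} [CommRing R] (N : Type u) [AddCommGroup N] [Module R N]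
    {n : ℕ} (x : Fin n → R) (i : Fin n) : Submodule R N :=
  Ideal.span (x '' Set.Iio i) • (⊤ : Submodule R N)

/-- `x₁, …, xₙ` is an `𝔞`-filter regular sequence on `N`: all terms lie in `𝔞`, and the support of
`((x₁, …, xᵢ₋₁)N :_N xᵢ) / (x₁, …, xᵢ₋₁)N` is contained in `V(𝔞)` for every `i`. -/
def IsFilterRegularSeq {R : Type u} [CommRing R] (𝔞 : Ideal R)
    (N : Type u) [AddCommGroup N] [Module R N] {n : ℕ} (x : Fin n → R) : Prop :=
  (∀ i, x i ∈ 𝔞) ∧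
    ∀ i, Module.support R
        (colonElem (initialSubmodule N x i) (x i) ⧸
          (initialSubmodule N x i).submoduleOf (colonElem (initialSubmodule N x i) (x i))) ⊆
      PrimeSpectrum.zeroLocus (𝔞 : Set R)

end

/-! Both sides are reduced to one module, obtained from `N` by forming `L ↦ L_y / L` (`locCoker`)
successively for `y = x₁, …, xₙ`. Let `D` be a system of quotients killed by powers of `y`.
Multiplication by `y` is bijective on `L_y`, so `Ext(D t, L_y) = 0`. If moreover the limits of `Ext`
into the `y`-power torsion of `L` vanish in degrees `p + 1` and `p + 2`, then the limit of `Extᵖ⁺¹(D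
t, L)` is that of `Extᵖ(D t, L_y / L)` (`nonempty_limExt_iso_locCoker`). For `D t = M / 𝔞ᵗM`, filter
regularity makes the `x₁`-power torsion of `N` an `𝔞`-torsion module, and Artin–Rees shows that the
limits into `𝔞`-torsion modules vanish above the projective dimension of `M` (`vanish_of_torsion`).
The step can be repeated because `x₂, …, xₙ` stays filter regular on `N_{x₁} / N`
(`powRegular_locCoker`). These modules need not be finitely generated, so regularity is tested on
elements, with powers of one `a ∈ 𝔞` at a time (`PowRegular`). For `D t = R / 𝔟ᵗ` with `𝔟 = (x₁, …,
xₙ)`, no regularity is needed: the torsion terms vanish because they involve fewer non-torsion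
generators (`vanish_of_length_lt`). After `n` steps the module is `𝔟`-torsion and the degree is 0,
so the limit is the iterated cokernel itself. -/

noncomputable section

/-! ### Derived-functor `Ext` and `Ext` of abelian categories agree naturally in the first variable.
-/

namespace ExtComparison

variable {R : Type u} [CommRing R]

section ExtMk

variable {X : ModuleCat.{u} R} (P : ProjectiveResolution X) (Y : ModuleCat.{u} R)

lemma smul_extMk {Y : ModuleCat.{u} R} {n : ℕ} (r : R) (f : P.complex.X n ⟶ Y) (m : ℕ)
    (hm : n + 1 = m) (hf : P.complex.d m n ≫ f = 0) :
    P.extMk (r • f) m hm (by simp [hf]) = r • P.extMk f m hm hf := by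
  rw [Abelian.Ext.smul_eq_comp_mk₀, P.extMk_comp_mk₀]
  simp

/-- Degree 0 has no preceding term, so it is treated apart: the resolution, indexed as a cochain
complex, is zero in degree 1, and the only coboundary is 0. -/
lemma eq_zero_of_extMk_eq_zero {Y : ModuleCat.{u} R} (f : P.complex.X 0 ⟶ Y)
    (hf : P.complex.d 1 0 ≫ f = 0) (h : P.extMk f 1 rfl hf = 0) : f = 0 := by
  rw [← P.extEquivCohomologyClass.apply_eq_iff_eq,
    P.extEquivCohomologyClass_extMk, P.extEquivCohomologyClass_zero,
    CochainComplex.HomComplex.CohomologyClass.mk_eq_zero_iff,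
    CochainComplex.HomComplex.Cocycle.toSingleMk_mem_coboundaries_iff _ _ _ _ _ 1 (by lia)] at h
  obtain ⟨g, hg⟩ := h
  have hz : IsZero (P.cochainComplex.X 1) :=
    CochainComplex.isZero_of_isStrictlyLE P.cochainComplex 0 1
  rw [hz.eq_of_src g 0, comp_zero] at hg
  rw [← cancel_epi (P.cochainComplexXIso (-(0 : ℕ)) 0 rfl).hom, ← hg, comp_zero]

/-- The cocycles of degree `n` of the complex `Hom(P, Y)`. -/
def cocycles (n : ℕ) : Submodule R (P.complex.X n ⟶ Y) :=
  LinearMap.ker (Linear.leftComp R Y (P.complex.d (n + 1) n))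

/-- The class in `Ext` of a cocycle of the complex `Hom(P, Y)`. -/
def cocyclesToExt (n : ℕ) : cocycles P Y n →ₗ[R] Abelian.Ext X Y n where
  toFun c := P.extMk c.1 (n + 1) rfl c.2
  map_add' _ _ := (P.add_extMk _ _ _ _ _ _).symm
  map_smul' r _ := smul_extMk P r _ _ _ _

lemma cocyclesToExt_surjective (n : ℕ) : Function.Surjective (cocyclesToExt P Y n) := by
  intro α
  obtain ⟨f, hf, h⟩ := P.extMk_surjective α (n + 1) rfl
  exact ⟨⟨f, hf⟩, h⟩

lemma cocyclesToExt_eq_zero_iff {n p : ℕ} (hp : p + 1 = n) (c : cocycles P Y n) :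
    cocyclesToExt P Y n c = 0 ↔ ∃ g : P.complex.X p ⟶ Y, P.complex.d n p ≫ g = c.1 :=
  P.extMk_eq_zero_iff c.1 (n + 1) rfl c.2 p hp

/-- The cycles of the complex `Hom(P, Y)` as cocycles. -/
def cyclesToCocycles (n : ℕ) :
    (P.complex.linearYonedaObj R Y).cycles n →ₗ[R] cocycles P Y n :=
  LinearMap.codRestrict (cocycles P Y n) ((P.complex.linearYonedaObj R Y).iCycles n).hom
    fun c => congr($((P.complex.linearYonedaObj R Y).iCycles_d n (n + 1)) c)

lemma cyclesToCocycles_surjective (n : ℕ) : Function.Surjective (cyclesToCocycles P Y n) := by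
  rintro ⟨f, hf⟩
  let K := P.complex.linearYonedaObj R Y
  let k : ModuleCat.of R (cocycles P Y n) ⟶ K.X n := ModuleCat.ofHom (cocycles P Y n).subtype
  have hk : k ≫ K.d n (n + 1) = 0 := by
    ext c
    exact c.2
  refine ⟨(K.liftCycles k (n + 1) (by simp) hk) ⟨f, hf⟩, ?_⟩
  apply Subtype.ext
  exact congr($(K.liftCycles_i k (n + 1) (by simp) hk) ⟨f, hf⟩)

lemma cocyclesToExt_toCycles (n p : ℕ) (f : P.complex.X p ⟶ Y) :
    cocyclesToExt P Y n (cyclesToCocycles P Y n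
      ((P.complex.linearYonedaObj R Y).toCycles p n f)) = 0 := by
  have h1 : (cyclesToCocycles P Y n ((P.complex.linearYonedaObj R Y).toCycles p n f)).1 =
      P.complex.d n p ≫ f :=
    congr($((P.complex.linearYonedaObj R Y).toCycles_i p n) f)
  by_cases hn : p + 1 = n
  · exact (cocyclesToExt_eq_zero_iff P Y hn _).2 ⟨f, h1.symm⟩
  · have : cyclesToCocycles P Y n ((P.complex.linearYonedaObj R Y).toCycles p n f) = 0 := by
      apply Subtype.ext
      rw [h1, P.complex.shape n p (by simpa using hn), zero_comp]
      rfl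
    rw [this, map_zero]

/-- The cohomology of the complex `Hom(P, Y)` maps to `Ext`. -/
def homologyToExt (n : ℕ) :
    (P.complex.linearYonedaObj R Y).homology n ⟶ ModuleCat.of R (Abelian.Ext X Y n) :=
  ShortComplex.descHomology _ (ModuleCat.ofHom (cocyclesToExt P Y n ∘ₗ cyclesToCocycles P Y n))
    (by
      ext f
      exact cocyclesToExt_toCycles P Y n _ f)

lemma homologyπ_homologyToExt (n : ℕ) :
    (P.complex.linearYonedaObj R Y).homologyπ n ≫ homologyToExt P Y n =
      ModuleCat.ofHom (cocyclesToExt P Y n ∘ₗ cyclesToCocycles P Y n) :=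
  ShortComplex.π_descHomology _ _ _

lemma homologyToExt_homologyπ (n : ℕ) (c : (P.complex.linearYonedaObj R Y).cycles n) :
    homologyToExt P Y n ((P.complex.linearYonedaObj R Y).homologyπ n c) =
      cocyclesToExt P Y n (cyclesToCocycles P Y n c) :=
  congr($(homologyπ_homologyToExt P Y n) c)

lemma homologyπ_surjective {K : CochainComplex (ModuleCat.{u} R) ℕ} (n : ℕ) :
    Function.Surjective (K.homologyπ n) :=
  (ModuleCat.epi_iff_surjective _).1 inferInstance

instance isIso_homologyToExt (n : ℕ) : IsIso (homologyToExt P Y n) := by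
  rw [ConcreteCategory.isIso_iff_bijective]
  constructor
  · rw [injective_iff_map_eq_zero]
    intro h hh
    obtain ⟨c, rfl⟩ := homologyπ_surjective n h
    rw [homologyToExt_homologyπ] at hh
    have hi : Function.Injective ((P.complex.linearYonedaObj R Y).iCycles n) :=
      (ModuleCat.mono_iff_injective _).1 inferInstance
    rcases n with _ | p
    · have h0 := eq_zero_of_extMk_eq_zero P _ (cyclesToCocycles P Y 0 c).2 hh
      rw [hi (a₁ := c) (a₂ := 0) (h0.trans (map_zero _).symm), map_zero]
    · obtain ⟨f, hf⟩ := (cocyclesToExt_eq_zero_iff P Y rfl _).1 hh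
      have : c = (P.complex.linearYonedaObj R Y).toCycles p (p + 1) f := by
        apply hi
        refine hf.symm.trans ?_
        exact congr($((P.complex.linearYonedaObj R Y).toCycles_i p (p + 1)) f).symm
      rw [this]
      exact congr($((P.complex.linearYonedaObj R Y).toCycles_comp_homologyπ p (p + 1)) f)
  · intro e
    obtain ⟨c, rfl⟩ := cocyclesToExt_surjective P Y n e
    obtain ⟨c, rfl⟩ := cyclesToCocycles_surjective P Y n c
    exact ⟨_, homologyToExt_homologyπ P Y n c⟩

/-- The cohomology of the complex `Hom(P, Y)` is `Ext`. -/
def homologyIsoExt (n : ℕ) :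
    (P.complex.linearYonedaObj R Y).homology n ≅ ModuleCat.of R (Abelian.Ext X Y n) :=
  asIso (homologyToExt P Y n)

end ExtMk

section Naturality

variable {X X' : ModuleCat.{u} R} {P : ProjectiveResolution X} {P' : ProjectiveResolution X'}
  {f : X' ⟶ X} (φ : ProjectiveResolution.Hom P' P f) (Y : ModuleCat.{u} R)

/-- The map of complexes `Hom(P, Y) ⟶ Hom(P', Y)` induced by a map `P' ⟶ P`. -/
def linearYonedaMap : P.complex.linearYonedaObj R Y ⟶ P'.complex.linearYonedaObj R Y :=
  (HomologicalComplex.unopFunctor _ _).map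
    ((((linearYoneda R (ModuleCat.{u} R)).obj Y).rightOp.mapHomologicalComplex _).map φ.hom).op

lemma homologyMap_homologyToExt (n : ℕ) :
    HomologicalComplex.homologyMap (linearYonedaMap φ Y) n ≫ homologyToExt P' Y n =
      homologyToExt P Y n ≫
        ModuleCat.ofHom ((Abelian.Ext.mk₀ f).precompOfLinear R Y (zero_add n)) := by
  rw [← cancel_epi ((P.complex.linearYonedaObj R Y).homologyπ n)]
  rw [HomologicalComplex.homologyπ_naturality_assoc, homologyπ_homologyToExt]
  ext c
  have h1 : (cyclesToCocycles P' Y n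
      (HomologicalComplex.cyclesMap (linearYonedaMap φ Y) n c)).1 =
      φ.hom.f n ≫ (cyclesToCocycles P Y n c).1 :=
    congr($(HomologicalComplex.cyclesMap_i (linearYonedaMap φ Y) n) c)
  refine Eq.trans ?_ congr((Abelian.Ext.mk₀ f).comp $(homologyToExt_homologyπ P Y n c) (zero_add n)).symm
  refine Eq.trans ?_ (ProjectiveResolution.mk₀_comp_extMk (cyclesToCocycles P Y n c).1 (n + 1) rfl
    (cyclesToCocycles P Y n c).2 φ).symm
  have h2 : ∀ (a b : P'.complex.X n ⟶ Y) (h : a = b) (ha : P'.complex.d (n + 1) n ≫ a = 0)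
      (hb : P'.complex.d (n + 1) n ≫ b = 0),
      P'.extMk a (n + 1) rfl ha = P'.extMk b (n + 1) rfl hb := by
    rintro a _ rfl _ _
    rfl
  exact h2 _ _ h1 (cyclesToCocycles P' Y n _).2 _

/-- The functor `Ext` comes from a left derived functor with values in an opposite category.
Naturality is available there and has to be carried back through `unop`. -/
lemma iso_symm_naturality_unop {𝒟 : Type*} [Category 𝒟] {A A' B B' : 𝒟ᵒᵖ} {C C' : 𝒟}
    (e' : B' ≅ A') (e : B ≅ A) (u : A' ⟶ A) (v : B' ⟶ B) (w : C ⟶ C') (k' : B' ≅ op C')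
    (k : B ≅ op C) (h₁ : e'.hom ≫ u = v ≫ e.hom) (h₂ : v ≫ k.hom = k'.hom ≫ w.op) :
    u.unop ≫ e'.hom.unop ≫ k'.inv.unop = (e.hom.unop ≫ k.inv.unop) ≫ w := by
  have h₃ : k'.inv ≫ e'.hom ≫ u = w.op ≫ k.inv ≫ e.hom := by
    rw [h₁, Iso.inv_comp_eq, ← Category.assoc, ← Category.assoc, ← h₂]
    simp
  simpa using congr($(h₃).unop)

lemma isoExt_hom_naturality (n : ℕ) :
    (((Ext R (ModuleCat.{u} R) n).map f.op).app Y) ≫ (P'.isoExt n Y).hom =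
      (P.isoExt n Y).hom ≫ HomologicalComplex.homologyMap (linearYonedaMap φ Y) n := by
  let F := ((linearYoneda R (ModuleCat.{u} R)).obj Y).rightOp
  have h1 : (P'.isoLeftDerivedObj F n).inv ≫ (F.leftDerived n).map f =
      HomologicalComplex.homologyMap ((F.mapHomologicalComplex _).map φ.hom) n ≫
        (P.isoLeftDerivedObj F n).inv :=
    ProjectiveResolution.isoLeftDerivedObj_inv_naturality f P' P φ.hom
      (by simpa using φ.hom_f_zero_comp_π_f_zero) F n
  have h2 : HomologicalComplex.homologyMap ((F.mapHomologicalComplex _).map φ.hom) n ≫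
      ((P.complex.linearYonedaObj R Y).homologyOp n).hom =
      ((P'.complex.linearYonedaObj R Y).homologyOp n).hom ≫
        (HomologicalComplex.homologyMap (linearYonedaMap φ Y) n).op :=
    HomologicalComplex.homologyOp_hom_naturality (linearYonedaMap φ Y) n
  exact iso_symm_naturality_unop (P'.isoLeftDerivedObj F n).symm (P.isoLeftDerivedObj F n).symm
    _ _ _ ((P'.complex.linearYonedaObj R Y).homologyOp n)
    ((P.complex.linearYonedaObj R Y).homologyOp n) h1 h2

end Naturality

variable (R) in
/-- The functor `X ↦ Extⁿ(X, Y)` on modules, for the groups `Ext` of abelian categories. -/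
def extLeft (n : ℕ) (Y : ModuleCat.{u} R) : (ModuleCat.{u} R)ᵒᵖ ⥤ ModuleCat.{u} R where
  obj X := ModuleCat.of R (Abelian.Ext X.unop Y n)
  map f := ModuleCat.ofHom ((Abelian.Ext.mk₀ f.unop).precompOfLinear R Y (zero_add n))
  map_id X := by
    ext e
    exact Abelian.Ext.mk₀_id_comp e
  map_comp f g := by
    ext e
    exact (Abelian.Ext.mk₀_comp_mk₀_assoc g.unop f.unop e).symm

/-- The derived functor of `Hom` in its first variable agrees with the groups `Ext` of abelian
categories. -/
def extIso (n : ℕ) (Y : ModuleCat.{u} R) :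
    (Ext R (ModuleCat.{u} R) n).flip.obj Y ≅ extLeft R n Y :=
  NatIso.ofComponents
    (fun X => (projectiveResolution X.unop).isoExt n Y ≪≫
      homologyIsoExt (projectiveResolution X.unop) Y n)
    (fun {X X'} f => by
      let φ : ProjectiveResolution.Hom (projectiveResolution X'.unop)
          (projectiveResolution X.unop) f.unop :=
        ⟨ProjectiveResolution.lift f.unop _ _, by
          exact HomologicalComplex.congr_hom (ProjectiveResolution.lift_commutes f.unop
            (projectiveResolution X'.unop) (projectiveResolution X.unop)) 0⟩
      have h₁ := isoExt_hom_naturality φ Y n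
      have h₂ := homologyMap_homologyToExt φ Y n
      have h₃ : ((Ext R (ModuleCat.{u} R) n).flip.obj Y).map f ≫
          ((projectiveResolution X'.unop).isoExt n Y).hom ≫
          homologyToExt (projectiveResolution X'.unop) Y n =
          (((projectiveResolution X.unop).isoExt n Y).hom ≫
          homologyToExt (projectiveResolution X.unop) Y n) ≫ (extLeft R n Y).map f := by
        refine (Category.assoc _ _ _).symm.trans ?_
        refine congr($h₁ ≫ _).trans ?_
        refine (Category.assoc _ _ _).trans ?_
        refine congr(_ ≫ $h₂).trans ?_
        exact (Category.assoc _ _ _).symm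
      exact h₃)

end ExtComparison

/-! ### Direct limits of `Ext` along an inverse system. -/

namespace LimExt

open ExtComparison Abelian

variable {R : Type u} [CommRing R]

/-- Filtered colimits of modules are computed on elements, so a kernel element need only die, and a
target element need only be hit, at a later stage. -/
lemma isIso_colimMap_of_eventually {J : Type} [SmallCategory J] [IsFiltered J]
    {A B : J ⥤ ModuleCat.{u} R} (α : A ⟶ B)
    (hinj : ∀ j (a : A.obj j), α.app j a = 0 → ∃ (k : J) (f : j ⟶ k), A.map f a = 0)
    (hsurj : ∀ j (b : B.obj j), ∃ (k : J) (f : j ⟶ k) (a : A.obj k), α.app k a = B.map f b) :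
    IsIso (colimMap α) := by
  have := preservesSmallestFilteredColimits_of_preservesFilteredColimits
    (forget (ModuleCat.{u} R))
  have hα (j : J) (a : A.obj j) :
      colimMap α (colimit.ι A j a) = colimit.ι B j (α.app j a) :=
    congr($(ι_colimMap α j) a)
  have hA {j k : J} (f : j ⟶ k) (a : A.obj j) : colimit.ι A k (A.map f a) = colimit.ι A j a :=
    congr($(colimit.w A f) a)
  have hB {j k : J} (f : j ⟶ k) (b : B.obj j) : colimit.ι B k (B.map f b) = colimit.ι B j b :=
    congr($(colimit.w B f) b)
  rw [ConcreteCategory.isIso_iff_bijective]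
  constructor
  · rw [injective_iff_map_eq_zero]
    intro x hx
    obtain ⟨j, a, rfl⟩ := Concrete.colimit_exists_rep A x
    rw [hα] at hx
    obtain ⟨k, f, h⟩ := Concrete.colimit_rep_eq_zero R B j _ hx
    have h' : α.app k (A.map f a) = 0 := congr($(α.naturality f) a).trans h
    obtain ⟨l, g, hg⟩ := hinj k _ h'
    rw [← hA f, ← hA g, hg, map_zero]
  · intro y
    obtain ⟨j, b, rfl⟩ := Concrete.colimit_exists_rep B y
    obtain ⟨k, f, a, h⟩ := hsurj j b
    exact ⟨colimit.ι A k a, by rw [hα, h, hB]⟩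

variable (D : ℕᵒᵖ ⥤ ModuleCat.{u} R)

/-- The direct limit of the modules `Extᵖ(D t, L)` along an inverse system `D`. -/
def limExt (p : ℕ) (L : ModuleCat.{u} R) : ModuleCat.{u} R :=
  colimit (D.op ⋙ extLeft R p L)

/-- The restriction of a class along a transition map of an inverse system. -/
def res {p : ℕ} {L : ModuleCat.{u} R} {t s : ℕ} (h : t ≤ s) (ξ : Ext (D.obj (op t)) L p) :
    Ext (D.obj (op s)) L p :=
  (Ext.mk₀ (D.map (homOfLE h).op)).comp ξ (zero_add p)

/-- Every class in `Extᵖ(D t, L)` restricts to zero at a later stage of the inverse system `D`. -/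
def Vanish (p : ℕ) (L : ModuleCat.{u} R) : Prop :=
  ∀ (t : ℕ) (ξ : Ext (D.obj (op t)) L p), ∃ (s : ℕ) (h : t ≤ s), res D h ξ = 0

variable {D}

lemma res_res {p : ℕ} {L : ModuleCat.{u} R} {t s r : ℕ} (h : t ≤ s) (h' : s ≤ r)
    (ξ : Ext (D.obj (op t)) L p) : res D h' (res D h ξ) = res D (h.trans h') ξ := by
  simp only [res, Ext.mk₀_comp_mk₀_assoc]
  rw [← D.map_comp]
  rfl

lemma res_comp {p k q : ℕ} {L L' : ModuleCat.{u} R} {t s : ℕ} (h : t ≤ s)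
    (ξ : Ext (D.obj (op t)) L p) (β : Ext L L' k) (e : p + k = q) :
    res D h (ξ.comp β e) = (res D h ξ).comp β e :=
  (Ext.comp_assoc _ _ _ _ _ (by lia)).symm

lemma res_zero {p : ℕ} {L : ModuleCat.{u} R} {t s : ℕ} (h : t ≤ s) :
    res D h (0 : Ext (D.obj (op t)) L p) = 0 :=
  Ext.comp_zero _ _ _ _ _

variable (D) in
/-- The map of direct limits induced by composition with a class in `Ext`. -/
def limExtMap {p k q : ℕ} {L L' : ModuleCat.{u} R} (β : Ext L L' k) (e : p + k = q) :
    D.op ⋙ extLeft R p L ⟶ D.op ⋙ extLeft R q L' where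
  app t := ModuleCat.ofHom (β.postcompOfLinear R (D.obj t.unop) e)
  naturality t s f := by
    ext ξ
    exact Ext.comp_assoc (Ext.mk₀ (D.op.map f).unop) ξ β (zero_add p) e (by lia)

lemma nonempty_limExt_iso {p k q : ℕ} {L L' : ModuleCat.{u} R} (β : Ext L L' k) (e : p + k = q)
    (hinj : ∀ t (ξ : Ext (D.obj (op t)) L p), ξ.comp β e = 0 →
      ∃ (s : ℕ) (h : t ≤ s), res D h ξ = 0)
    (hsurj : ∀ t (ζ : Ext (D.obj (op t)) L' q), ∃ (s : ℕ) (h : t ≤ s)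
      (ξ : Ext (D.obj (op s)) L p), ξ.comp β e = res D h ζ) :
    Nonempty (limExt D p L ≅ limExt D q L') := by
  have := isIso_colimMap_of_eventually (limExtMap D β e)
    (fun j a ha => by
      obtain ⟨s, h, hs⟩ := hinj j.unop.unop a ha
      exact ⟨op (op s), (homOfLE h).op.op, hs⟩)
    (fun j b => by
      obtain ⟨s, h, ξ, hs⟩ := hsurj j.unop.unop b
      exact ⟨op (op s), (homOfLE h).op.op, ξ, hs⟩)
  exact ⟨@asIso _ _ _ _ _ this⟩

section ShortExact

variable {S : ShortComplex (ModuleCat.{u} R)} (hS : S.ShortExact) {p : ℕ}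

include hS

/-- In the long exact sequence at each stage, the obstructions to injectivity and surjectivity come
from `S.X₁` in degrees `p` and `p + 1`, and they die later in the system. -/
lemma nonempty_limExt_iso_of_vanish_left (h₀ : Vanish D p S.X₁) (h₁ : Vanish D (p + 1) S.X₁) :
    Nonempty (limExt D p S.X₂ ≅ limExt D p S.X₃) := by
  refine nonempty_limExt_iso (Ext.mk₀ S.g) (add_zero p) (fun t ξ hξ => ?_) (fun t ζ => ?_)
  · obtain ⟨η, rfl⟩ := Ext.covariant_sequence_exact₂ _ hS ξ hξ
    obtain ⟨s, h, hs⟩ := h₀ t η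
    exact ⟨s, h, by rw [res_comp, hs, Ext.zero_comp]⟩
  · obtain ⟨s, h, hs⟩ := h₁ t (ζ.comp hS.extClass rfl)
    rw [res_comp] at hs
    exact ⟨s, h, Ext.covariant_sequence_exact₃ _ hS _ rfl hs⟩

lemma nonempty_limExt_iso_of_vanish_middle (h₀ : Vanish D p S.X₂) (h₁ : Vanish D (p + 1) S.X₂) :
    Nonempty (limExt D p S.X₃ ≅ limExt D (p + 1) S.X₁) := by
  refine nonempty_limExt_iso hS.extClass rfl (fun t ξ hξ => ?_) (fun t ζ => ?_)
  · obtain ⟨η, rfl⟩ := Ext.covariant_sequence_exact₃ _ hS ξ rfl hξ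
    obtain ⟨s, h, hs⟩ := h₀ t η
    exact ⟨s, h, by rw [res_comp, hs, Ext.zero_comp]⟩
  · obtain ⟨s, h, hs⟩ := h₁ t (ζ.comp (Ext.mk₀ S.f) (add_zero _))
    rw [res_comp] at hs
    exact ⟨s, h, Ext.covariant_sequence_exact₁ _ hS _ hs rfl⟩

lemma vanish_middle (h₁ : Vanish D p S.X₁) (h₃ : Vanish D p S.X₃) : Vanish D p S.X₂ := by
  intro t ξ
  obtain ⟨s, h, hs⟩ := h₃ t (ξ.comp (Ext.mk₀ S.g) (add_zero _))
  rw [res_comp] at hs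
  obtain ⟨η, hη⟩ := Ext.covariant_sequence_exact₂ _ hS _ hs
  obtain ⟨r, h', hr⟩ := h₁ s η
  exact ⟨r, h.trans h', by rw [← res_res h h', ← hη, res_comp, hr, Ext.zero_comp]⟩

lemma vanish_left (h₃ : Vanish D p S.X₃) (h₂ : Vanish D (p + 1) S.X₂) :
    Vanish D (p + 1) S.X₁ := by
  intro t ξ
  obtain ⟨s, h, hs⟩ := h₂ t (ξ.comp (Ext.mk₀ S.f) (add_zero _))
  rw [res_comp] at hs
  obtain ⟨η, hη⟩ := Ext.covariant_sequence_exact₁ _ hS _ hs rfl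
  obtain ⟨r, h', hr⟩ := h₃ s η
  exact ⟨r, h.trans h', by rw [← res_res h h', ← hη, res_comp, hr, Ext.zero_comp]⟩

end ShortExact

/-- If `y` acts bijectively on `L` and every term of the inverse system `D` is killed by a power
of `y`, then the groups `Extᵖ(D t, L)` vanish. -/
lemma vanish_of_bijective_smul {y : R} {L : ModuleCat.{u} R}
    (hy : Function.Bijective fun l : L => y • l)
    (hD : ∀ t, ∃ k, ∀ x : D.obj (op t), y ^ k • x = 0) (p : ℕ) : Vanish D p L := by
  intro t ξ
  refine ⟨t, le_rfl, ?_⟩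
  suffices ξ = 0 by rw [this, res_zero]
  obtain ⟨k, hk⟩ := hD t
  have hk' : y ^ k • 𝟙 (D.obj (op t)) = 0 := by
    ext x
    exact hk x
  -- The scalar `y ^ k` acts on `Ext` as zero through the first argument and invertibly through the
  -- second.
  have h0 : y ^ k • ξ = 0 := by
    rw [← Ext.mk₀_id_comp ξ, ← Ext.smul_comp, ← Ext.mk₀_smul, hk', Ext.mk₀_zero, Ext.zero_comp]
  have hiso : IsIso (y ^ k • 𝟙 L) := by
    rw [ConcreteCategory.isIso_iff_bijective]
    have : (⇑(ConcreteCategory.hom (y ^ k • 𝟙 L)) : L → L) = (fun l : L => y • l)^[k] := by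
      rw [smul_iterate]
      rfl
    rw [this]
    exact hy.iterate k
  rw [Ext.smul_eq_comp_mk₀] at h0
  rw [← Ext.comp_mk₀_id ξ, ← IsIso.hom_inv_id (y ^ k • 𝟙 L), ← Ext.mk₀_comp_mk₀,
    ← Ext.comp_assoc_of_third_deg_zero, h0, Ext.zero_comp]

/-! ### Kernel and cokernel of `L → L_y`, and the degree shift they give. -/

section Localization

variable (y : R) (L : ModuleCat.{u} R)

/-- The localization map `L → L_y`. -/
abbrev locMap : L →ₗ[R] LocalizedModule (Submonoid.powers y) L :=
  LocalizedModule.mkLinearMap (Submonoid.powers y) L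

/-- The cokernel of the localization map `L → L_y`; this is the first local cohomology module of
`L` with respect to `y`. -/
def locCoker : ModuleCat.{u} R :=
  ModuleCat.of R (LocalizedModule (Submonoid.powers y) L ⧸ LinearMap.range (locMap y L))

/-- The map of `L` onto its image in `L_y`. -/
def toLocRange : L →ₗ[R] LinearMap.ker (LinearMap.range (locMap y L)).mkQ :=
  LinearMap.codRestrict _ (locMap y L) (by simp)

lemma toLocRange_surjective : Function.Surjective (toLocRange y L) := by
  rintro ⟨z, hz⟩
  rw [Submodule.ker_mkQ] at hz
  obtain ⟨l, rfl⟩ := hz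
  exact ⟨l, rfl⟩

/-- The `y`-power torsion submodule of `L`, as the kernel of `L → L_y`. -/
def powTorsion : ModuleCat.{u} R := ModuleCat.of R (LinearMap.ker (toLocRange y L))

variable {y L}

lemma locMap_eq_zero_iff {l : L} : locMap y L l = 0 ↔ ∃ k, y ^ k • l = 0 := by
  rw [IsLocalizedModule.eq_zero_iff (Submonoid.powers y)]
  constructor
  · rintro ⟨⟨_, k, rfl⟩, h⟩
    exact ⟨k, h⟩
  · rintro ⟨k, h⟩
    exact ⟨⟨y ^ k, k, rfl⟩, h⟩

lemma mem_ker_toLocRange {l : L} : l ∈ LinearMap.ker (toLocRange y L) ↔ ∃ k, y ^ k • l = 0 := by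
  rw [← locMap_eq_zero_iff, LinearMap.mem_ker, ← Subtype.val_inj]
  rfl

variable (y L) in
lemma bijective_smul_localizedModule :
    Function.Bijective fun z : LocalizedModule (Submonoid.powers y) L => y • z :=
  (Module.End.isUnit_iff _).1
    (IsLocalizedModule.map_units (locMap y L) (⟨y, Submonoid.mem_powers y⟩ : Submonoid.powers y))

lemma exists_pow_smul_mem_range (z : LocalizedModule (Submonoid.powers y) L) :
    ∃ (k : ℕ) (l : L), y ^ k • z = locMap y L l := by
  obtain ⟨⟨l, ⟨_, k, rfl⟩⟩, h⟩ := IsLocalizedModule.surj (Submonoid.powers y) (locMap y L) z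
  exact ⟨k, l, h⟩

lemma exists_pow_smul_locCoker_eq_zero (z : locCoker y L) : ∃ k, y ^ k • z = 0 := by
  obtain ⟨z, rfl⟩ := Submodule.Quotient.mk_surjective _ z
  obtain ⟨k, l, h⟩ := exists_pow_smul_mem_range z
  exact ⟨k, (Submodule.Quotient.mk_eq_zero _).2 ⟨l, h.symm⟩⟩

/-- An element of `L_y / L` is killed by a power of `a` if every element of `L` is. -/
lemma exists_pow_smul_locCoker_eq_zero_of_forall {a : R} (ha : ∀ l : L, ∃ m, a ^ m • l = 0)
    (z : locCoker y L) : ∃ m, a ^ m • z = 0 := by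
  obtain ⟨z, rfl⟩ := Submodule.Quotient.mk_surjective _ z
  obtain ⟨k, l, h⟩ := exists_pow_smul_mem_range z
  obtain ⟨m, hm⟩ := ha l
  refine ⟨m, ?_⟩
  have h0 : y ^ k • a ^ m • z = y ^ k • (0 : LocalizedModule (Submonoid.powers y) L) := by
    rw [smul_comm, h, ← map_smul, hm, map_zero, smul_zero]
  have hinj := (bijective_smul_localizedModule y L).injective.iterate k
  rw [smul_iterate] at hinj
  have : a ^ m • z = 0 := hinj h0
  exact congr(Submodule.Quotient.mk (p := LinearMap.range (locMap y L)) $this)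

lemma exists_pow_smul_powTorsion_eq_zero_of_forall {a : R} (ha : ∀ l : L, ∃ m, a ^ m • l = 0)
    (z : powTorsion y L) : ∃ m, a ^ m • z = 0 := by
  obtain ⟨m, hm⟩ := ha z.1
  exact ⟨m, Subtype.ext hm⟩

lemma exists_pow_smul_powTorsion_eq_zero (z : powTorsion y L) : ∃ m, y ^ m • z = 0 := by
  obtain ⟨m, hm⟩ := mem_ker_toLocRange.1 z.2
  exact ⟨m, Subtype.ext hm⟩

end Localization

section Step

variable {D : ℕᵒᵖ ⥤ ModuleCat.{u} R} {y : R} (L : ModuleCat.{u} R)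
  (hD : ∀ t, ∃ k, ∀ x : D.obj (op t), y ^ k • x = 0)

include hD

lemma vanish_localizedModule (p : ℕ) :
    Vanish D p (ModuleCat.of R (LocalizedModule (Submonoid.powers y) L)) :=
  vanish_of_bijective_smul (bijective_smul_localizedModule y L) hD p

/-- The map `L → L_y` need not be injective, so it is factored through its image: removing the
torsion keeps the degree, and passing from the image to the cokernel lowers it by one. -/
lemma nonempty_limExt_iso_locCoker {p : ℕ} (h₁ : Vanish D (p + 1) (powTorsion y L))
    (h₂ : Vanish D (p + 2) (powTorsion y L)) :
    Nonempty (limExt D (p + 1) L ≅ limExt D p (locCoker y L)) := by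
  obtain ⟨e⟩ := nonempty_limExt_iso_of_vanish_left
    (LinearMap.shortExact_shortComplexKer (toLocRange_surjective y L)) h₁ h₂
  obtain ⟨e'⟩ := nonempty_limExt_iso_of_vanish_middle (p := p)
    (LinearMap.shortExact_shortComplexKer (Submodule.mkQ_surjective (LinearMap.range (locMap y L))))
    (vanish_localizedModule L hD _) (vanish_localizedModule L hD _)
  exact ⟨e ≪≫ e'.symm⟩

lemma vanish_of_vanish_locCoker {p : ℕ} (h₁ : Vanish D (p + 1) (powTorsion y L))
    (h₂ : Vanish D p (locCoker y L)) : Vanish D (p + 1) L :=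
  vanish_middle (LinearMap.shortExact_shortComplexKer (toLocRange_surjective y L)) h₁
    (vanish_left (LinearMap.shortExact_shortComplexKer
      (Submodule.mkQ_surjective (LinearMap.range (locMap y L)))) h₂ (vanish_localizedModule L hD _))

end Step

/-! ### Artin–Rees and vanishing on torsion modules. -/

lemma mem_smul_top_of_coe_mem_smul {M : Type*} [AddCommGroup M] [Module R M] {I : Ideal R}
    {W : Submodule R M} {x : W} (hx : (x : M) ∈ I • W) : x ∈ I • (⊤ : Submodule R W) := by
  have h : Submodule.map W.subtype (I • (⊤ : Submodule R W)) = I • W := by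
    rw [Submodule.map_smul'', Submodule.map_subtype_top]
  rw [← h] at hx
  obtain ⟨x', hx', h⟩ := hx
  rwa [← Subtype.ext h]

/-- The inclusion of the submodule `𝔟ˢM` of `M`. -/
def powSmulι (𝔟 : Ideal R) (s : ℕ) (M : ModuleCat.{u} R) :
    ModuleCat.of R (𝔟 ^ s • ⊤ : Submodule R M) ⟶ M :=
  ModuleCat.ofHom (𝔟 ^ s • ⊤ : Submodule R M).subtype

lemma mk₀_comp_eq_zero_of_forall_mem {𝔟 : Ideal R} {s p : ℕ} {X M L : ModuleCat.{u} R}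
    {ξ : Ext M L p} (hξ : (Ext.mk₀ (powSmulι 𝔟 s M)).comp ξ (zero_add p) = 0) (f : X ⟶ M)
    (hf : ∀ x, f x ∈ (𝔟 ^ s • ⊤ : Submodule R M)) : (Ext.mk₀ f).comp ξ (zero_add p) = 0 := by
  have h : f = ModuleCat.ofHom (LinearMap.codRestrict _ f.hom hf) ≫ powSmulι 𝔟 s M := rfl
  rw [h, ← Ext.mk₀_comp_mk₀_assoc, hξ, Ext.comp_zero]

lemma exists_pow_smul_eq_zero_of_finite {𝔟 : Ideal R} {M L : Type*} [AddCommGroup M] [Module R M]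
    [AddCommGroup L] [Module R L] [Module.Finite R M]
    (hL : ∀ l : L, ∃ m, ∀ c ∈ 𝔟 ^ m, c • l = 0) (f : M →ₗ[R] L) :
    ∃ s, ∀ x ∈ (𝔟 ^ s • ⊤ : Submodule R M), f x = 0 := by
  obtain ⟨S, hS⟩ := Module.Finite.fg_top (R := R) (M := M)
  choose m hm using hL
  refine ⟨S.sup fun x => m (f x), fun x hx => ?_⟩
  induction hx using Submodule.smul_induction_on' with
  | smul c hc x hx =>
    have hx' : x ∈ Submodule.span R (S : Set M) := by rw [hS]; exact hx
    rw [map_smul]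
    induction hx' using Submodule.span_induction with
    | mem x h =>
      exact hm _ _ (Ideal.pow_le_pow_right (Finset.le_sup (f := fun x => m (f x)) h) hc)
    | zero => simp
    | add x y _ _ h₁ h₂ => rw [map_add, smul_add, h₁ trivial, h₂ trivial, add_zero]
    | smul r x _ h => rw [map_smul, smul_comm, h trivial, smul_zero]
  | add x _ y _ h₁ h₂ => rw [map_add, h₁, h₂, add_zero]

/-- A class in `Extᵖ(M, L)`, for a finitely generated module `M` over a Noetherian ring and a
`𝔟`-torsion module `L`, restricts to zero on `𝔟ˢM` for some `s`. -/
lemma exists_mk₀_powSmulι_comp_eq_zero [IsNoetherianRing R] (𝔟 : Ideal R) (L : ModuleCat.{u} R)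
    (hL : ∀ l : L, ∃ m, ∀ c ∈ 𝔟 ^ m, c • l = 0) (p : ℕ) :
    ∀ (M : ModuleCat.{u} R) [Module.Finite R M] (ξ : Ext M L p),
      ∃ s, (Ext.mk₀ (powSmulι 𝔟 s M)).comp ξ (zero_add p) = 0 := by
  induction p with
  | zero =>
    intro M _ ξ
    obtain ⟨s, hs⟩ := exists_pow_smul_eq_zero_of_finite hL (Ext.homEquiv₀ ξ).hom
    refine ⟨s, ?_⟩
    rw [← Ext.mk₀_homEquiv₀_apply ξ, Ext.mk₀_comp_mk₀, Ext.mk₀_eq_zero_iff]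
    ext x
    exact hs x.1 x.2
  | succ p ih =>
    intro M _ ξ
    obtain ⟨n, g, hg⟩ := Module.Finite.exists_fin' R M
    have hS := LinearMap.shortExact_shortComplexKer hg
    have : Projective (ModuleCat.of R (Fin n → R)) :=
      ModuleCat.projective_of_free (Pi.basisFun R (Fin n))
    obtain ⟨η, rfl⟩ := Ext.contravariant_sequence_exact₃ hS L ξ (Ext.eq_zero_of_projective _)
      (add_comm 1 p)
    obtain ⟨r, hr⟩ := ih (ModuleCat.of R (LinearMap.ker g)) η
    -- Artin–Rees for `K = ker g` in the free module `F`: `𝔟ᵏ⁺ʳF ∩ K = 𝔟ʳ(𝔟ᵏF ∩ K) ⊆ 𝔟ʳK`, where `η`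
    -- already vanishes. The left side is the kernel of `𝔟ᵏ⁺ʳF → 𝔟ᵏ⁺ʳM`.
    obtain ⟨k, hk⟩ := Ideal.exists_pow_inf_eq_pow_smul 𝔟 (LinearMap.ker g)
    have hmap : Submodule.map g (𝔟 ^ (k + r) • ⊤) = 𝔟 ^ (k + r) • ⊤ := by
      rw [Submodule.map_smul'', Submodule.map_top, LinearMap.range_eq_top.2 hg]
    let g' : (𝔟 ^ (k + r) • ⊤ : Submodule R (Fin n → R)) →ₗ[R] (𝔟 ^ (k + r) • ⊤ : Submodule R M) :=
      g.restrict fun x hx => hmap ▸ ⟨x, hx, rfl⟩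
    have hg' : Function.Surjective g' := by
      rintro ⟨z, hz⟩
      obtain ⟨x, hx, rfl⟩ := hmap.symm ▸ hz
      exact ⟨⟨x, hx⟩, rfl⟩
    have hS' := LinearMap.shortExact_shortComplexKer hg'
    let τ₁ : LinearMap.ker g' →ₗ[R] LinearMap.ker g :=
      LinearMap.codRestrict _
        ((𝔟 ^ (k + r) • ⊤ : Submodule R (Fin n → R)).subtype ∘ₗ (LinearMap.ker g').subtype)
        fun x => congr(Subtype.val $(x.2))
    let τ : g'.shortComplexKer ⟶ g.shortComplexKer :=
      { τ₁ := ModuleCat.ofHom τ₁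
        τ₂ := ModuleCat.ofHom (𝔟 ^ (k + r) • ⊤ : Submodule R (Fin n → R)).subtype
        τ₃ := powSmulι 𝔟 (k + r) M
        comm₁₂ := rfl
        comm₂₃ := rfl }
    refine ⟨k + r, ?_⟩
    have h₁ : (Ext.mk₀ (powSmulι 𝔟 (k + r) M)).comp hS.extClass (zero_add 1) =
        hS'.extClass.comp (Ext.mk₀ τ.τ₁) (add_zero 1) :=
      (ShortComplex.ShortExact.extClass_naturality hS' hS τ).symm
    rw [← Ext.comp_assoc _ _ _ (zero_add 1) (add_comm 1 p) (by lia), h₁,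
      Ext.comp_assoc_of_second_deg_zero]
    have h₂ : (Ext.mk₀ τ.τ₁).comp η (zero_add p) = 0 := by
      refine mk₀_comp_eq_zero_of_forall_mem hr τ.τ₁ fun x => mem_smul_top_of_coe_mem_smul ?_
      have hx : x.1.1 ∈ 𝔟 ^ (k + r) • ⊤ ⊓ LinearMap.ker g := ⟨x.1.2, congr(Subtype.val $(x.2))⟩
      rw [hk _ (Nat.le_add_right k r), Nat.add_sub_cancel_left] at hx
      exact Submodule.smul_mono le_rfl inf_le_right hx
    rw [h₂, Ext.comp_zero]

/-- Let `D` be the inverse system of the quotients `M / 𝔟ᵗM` of a finitely generated module `M` of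
projective dimension less than `p`. The direct limit of `Extᵖ(D t, L)` vanishes for all
`𝔟`-torsion modules `L`. -/
lemma vanish_of_torsion [IsNoetherianRing R] {𝔟 : Ideal R} {M : ModuleCat.{u} R}
    [Module.Finite R M] {D : ℕᵒᵖ ⥤ ModuleCat.{u} R} (π : (Functor.const ℕᵒᵖ).obj M ⟶ D)
    (hπ : ∀ t, Function.Surjective (π.app t))
    (hker : ∀ t, LinearMap.ker (π.app t).hom = 𝔟 ^ unop t • ⊤)
    {L : ModuleCat.{u} R} (hL : ∀ l : L, ∃ m, ∀ c ∈ 𝔟 ^ m, c • l = 0) {p : ℕ}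
    [HasProjectiveDimensionLT M p] : Vanish D p L := by
  intro t ξ
  have hM := HasProjectiveDimensionLT.subsingleton M p p le_rfl L
  rcases p with _ | p
  · refine ⟨t, le_rfl, ?_⟩
    have : Epi (π.app (op t)) := (ModuleCat.epi_iff_surjective _).2 (hπ _)
    rw [Ext.precomp_mk₀_injective_of_epi L (π.app (op t)) (a₁ := ξ) (a₂ := 0)
      (Subsingleton.elim (α := Ext M L 0) _ _), res_zero]
  · have hS (s : ℕ) := LinearMap.shortExact_shortComplexKer (f := (π.app (op s)).hom) (hπ (op s))
    obtain ⟨η, rfl⟩ := Ext.contravariant_sequence_exact₃ (hS t) L ξ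
      (Subsingleton.elim (α := Ext M L (p + 1)) _ _) (add_comm 1 p)
    have hfin : Module.Finite R (LinearMap.ker (π.app (op t)).hom) :=
      have : IsNoetherian R (((Functor.const ℕᵒᵖ).obj M).obj (op t)) :=
        isNoetherian_of_isNoetherianRing_of_finite R M
      Module.Finite.of_fg (IsNoetherian.noetherian _)
    obtain ⟨r, hr⟩ := exists_mk₀_powSmulι_comp_eq_zero 𝔟 L hL p
      (ModuleCat.of R (LinearMap.ker (π.app (op t)).hom)) η
    -- The kernel at stage `t + r` is exactly `𝔟ʳ` times the kernel at stage `t`, so `η` dies on it.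
    have hle : LinearMap.ker (π.app (op (t + r))).hom ≤ 𝔟 ^ r • LinearMap.ker (π.app (op t)).hom := by
      rw [hker, hker, ← Submodule.mul_smul, ← pow_add, add_comm r t]
    have hle' : LinearMap.ker (π.app (op (t + r))).hom ≤ LinearMap.ker (π.app (op t)).hom :=
      hle.trans Submodule.smul_le_right
    let τ : (π.app (op (t + r))).hom.shortComplexKer ⟶ (π.app (op t)).hom.shortComplexKer :=
      { τ₁ := ModuleCat.ofHom (Submodule.inclusion hle')
        τ₂ := 𝟙 M
        τ₃ := D.map (homOfLE (Nat.le_add_right t r)).op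
        comm₁₂ := rfl
        comm₂₃ := π.naturality (homOfLE (Nat.le_add_right t r)).op }
    refine ⟨t + r, Nat.le_add_right t r, ?_⟩
    have h₁ : (Ext.mk₀ (D.map (homOfLE (Nat.le_add_right t r)).op)).comp (hS t).extClass
        (zero_add 1) = (hS (t + r)).extClass.comp (Ext.mk₀ τ.τ₁) (add_zero 1) :=
      (ShortComplex.ShortExact.extClass_naturality (hS (t + r)) (hS t) τ).symm
    have h₂ : (Ext.mk₀ τ.τ₁).comp η (zero_add p) = 0 :=
      mk₀_comp_eq_zero_of_forall_mem hr τ.τ₁ fun x => mem_smul_top_of_coe_mem_smul (hle x.2)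
    refine (Ext.comp_assoc _ _ _ (zero_add 1) (add_comm 1 p) (by lia)).symm.trans ?_
    refine congr(Ext.comp $h₁ η (add_comm 1 p)).trans ?_
    refine (Ext.comp_assoc_of_second_deg_zero _ _ _ _).trans ?_
    rw [h₂, Ext.comp_zero]

/-! ### Filter regularity on elements and its passage to `L_z / L`. -/

/-- Every multiplication by a term of the list `zs` on the quotient of `L` by `P` and the preceding
terms has a kernel consisting of elements killed by powers of `a`. -/
def PowRegular (a : R) {L : Type u} [AddCommGroup L] [Module R L] :
    List R → Submodule R L → Prop
  | [], _ => True
  | w :: ws, P => (∀ l, w • l ∈ P → ∃ m, a ^ m • l ∈ P) ∧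
      PowRegular a ws (P ⊔ LinearMap.range (LinearMap.lsmul R L w))

/-- Let `f : A → B` be a map whose kernel modulo `P` and `Q` is killed by powers of `a` and
whose image modulo `Q` is the kernel of a surjective, locally nilpotent multiplication
by `z` on `B`. Then regularity up to powers of `a` passes from `A` modulo `P` to `B` modulo `Q`. -/
lemma PowRegular.of_ker_smul {a z : R} {A B : Type u} [AddCommGroup A] [Module R A]
    [AddCommGroup B] [Module R B] (f : A →ₗ[R] B) (hsurj : ∀ b : B, ∃ b', z • b' = b)
    (hnil : ∀ b : B, ∃ t, z ^ t • b = 0) {zs : List R} :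
    ∀ {P : Submodule R A} {Q : Submodule R B}, (∀ α, f α ∈ Q → ∃ m, a ^ m • α ∈ P) →
      (∀ α ∈ P, f α ∈ Q) → (∀ b, z • b ∈ Q → ∃ α, b - f α ∈ Q) → (∀ α, z • f α ∈ Q) →
      PowRegular a zs P → PowRegular a zs Q := by
  induction zs with
  | nil => exact fun _ _ _ _ _ => trivial
  | cons w ws ih =>
    intro P Q hinj hmap hex hz ⟨hP, hPs⟩
    -- By induction `aᵐ z b ∈ Q`, so `aᵐ b` is congruent to some `f α` modulo `Q`. Regularity of `w`
    -- modulo `P` applies to `α` up to a power of `a`.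
    have hQ' : ∀ (t : ℕ) (b : B), z ^ t • b ∈ Q → w • b ∈ Q → ∃ m, a ^ m • b ∈ Q := by
      intro t
      induction t with
      | zero => exact fun b hb _ => ⟨0, by simpa using hb⟩
      | succ t iht =>
        intro b hb hw
        obtain ⟨m, hm⟩ := iht (z • b) (by rwa [smul_smul, ← pow_succ])
          (by rw [smul_comm]; exact Q.smul_mem z hw)
        rw [smul_comm] at hm
        obtain ⟨α, hα⟩ := hex _ hm
        obtain ⟨r, hr⟩ := hinj (w • α) (by
          have h := Q.sub_mem (Q.smul_mem (a ^ m) hw) (Q.smul_mem w hα)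
          rw [smul_sub, smul_comm w (a ^ m) b, sub_sub_cancel, ← map_smul] at h
          exact h)
        rw [smul_comm] at hr
        obtain ⟨s, hs⟩ := hP _ hr
        refine ⟨s + (r + m), ?_⟩
        have h := Q.add_mem (Q.smul_mem (a ^ s) (Q.smul_mem (a ^ r) hα)) (hmap _ hs)
        simpa only [smul_sub, map_smul, sub_add_cancel, smul_smul, ← pow_add, add_assoc] using h
    have hQ : ∀ b, w • b ∈ Q → ∃ m, a ^ m • b ∈ Q := fun b hb => by
      obtain ⟨t, ht⟩ := hnil b
      exact hQ' t b (ht ▸ Q.zero_mem) hb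
    refine ⟨hQ, ih ?_ ?_ ?_ ?_ hPs⟩
    -- From `f α = q + w b`, multiplying by `z` gives `w z b ∈ Q`, hence `aᵐ z b ∈ Q` and `aᵐ b ≡ f
    -- α'`. Then `aᵐ α - w α'` is in `P` up to a power of `a`.
    · intro α hα
      obtain ⟨q, hq, _, ⟨b, rfl⟩, hb⟩ := Submodule.mem_sup.1 hα
      obtain ⟨m, hm⟩ := hQ (z • b) (by
        have h := Q.sub_mem (hz α) (Q.smul_mem z hq)
        rw [← hb, smul_add, add_sub_cancel_left, LinearMap.lsmul_apply, smul_comm] at h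
        exact h)
      rw [smul_comm] at hm
      obtain ⟨α', hα'⟩ := hex _ hm
      obtain ⟨r, hr⟩ := hinj (a ^ m • α - w • α') (by
        have h := Q.add_mem (Q.smul_mem (a ^ m) hq) (Q.smul_mem w hα')
        rw [map_sub, map_smul, map_smul, ← hb, LinearMap.lsmul_apply]
        convert h using 1
        rw [smul_add, smul_sub, smul_comm w (a ^ m) b]
        abel)
      refine ⟨r + m, Submodule.mem_sup.2 ⟨_, hr, w • a ^ r • α', ⟨_, rfl⟩, ?_⟩⟩
      rw [smul_sub, smul_smul, ← pow_add, smul_comm w, sub_add_cancel]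
    · intro α hα
      obtain ⟨p, hp, _, ⟨β, rfl⟩, rfl⟩ := Submodule.mem_sup.1 hα
      exact Submodule.mem_sup.2 ⟨_, hmap p hp, w • f β, ⟨_, rfl⟩, by simp⟩
    · intro b hb
      obtain ⟨q, hq, _, ⟨b', rfl⟩, h⟩ := Submodule.mem_sup.1 hb
      -- Divisibility by `z` allows correcting `b` by a multiple of `w` so that its product with `z`
      -- falls into `Q`.
      obtain ⟨b', rfl⟩ := hsurj b'
      obtain ⟨α, hα⟩ := hex (b - w • b') (by
        rw [smul_sub, ← h, LinearMap.lsmul_apply, smul_comm, add_sub_cancel_right]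
        exact hq)
      exact ⟨α, Submodule.mem_sup.2 ⟨_, hα, w • b', ⟨_, rfl⟩, by abel⟩⟩
    · exact fun α => Submodule.mem_sup_left (hz α)

lemma exists_pow_smul_eq_zero_of_ker {a z : R} {L : Type*} [AddCommGroup L] [Module R L]
    (h : ∀ l : L, z • l = 0 → ∃ m, a ^ m • l = 0) (k : ℕ) :
    ∀ l : L, z ^ k • l = 0 → ∃ m, a ^ m • l = 0 := by
  induction k with
  | zero => exact fun l hl => ⟨0, by simpa using hl⟩
  | succ k ih =>
    intro l hl
    obtain ⟨m, hm⟩ := ih (z • l) (by rwa [smul_smul, ← pow_succ])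
    obtain ⟨r, hr⟩ := h (a ^ m • l) (by rwa [smul_comm])
    exact ⟨r + m, by rwa [pow_add, mul_smul]⟩

/-- The map `l ↦ l / z` sends `L` onto the elements of `L_z / L` killed by `z`. Its kernel contains
`zL` and equals it up to powers of `a`, since `z`-power torsion is `a`-power torsion. On `L_z / L`,
`z` is surjective and locally nilpotent, so `PowRegular.of_ker_smul` applies. -/
lemma powRegular_locCoker {a z : R} {zs : List R} {L : ModuleCat.{u} R}
    (h : PowRegular a (z :: zs) (⊥ : Submodule R L)) :
    PowRegular a zs (⊥ : Submodule R (locCoker z L)) := by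
  obtain ⟨hz, hs⟩ := h
  let N := LinearMap.range (locMap z L)
  let e := LinearEquiv.ofBijective (LinearMap.lsmul R (LocalizedModule (Submonoid.powers z) L) z)
    (bijective_smul_localizedModule z L)
  have he (l : L) : z • e.symm (locMap z L l) = locMap z L l := e.apply_symm_apply _
  have he' (v : LocalizedModule (Submonoid.powers z) L) : e.symm (z • v) = v :=
    e.symm_apply_apply v
  let f : L →ₗ[R] locCoker z L := N.mkQ ∘ₗ e.symm.toLinearMap ∘ₗ locMap z L
  have hf (l : L) : f l = N.mkQ (e.symm (locMap z L l)) := rfl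
  have hN (v : LocalizedModule (Submonoid.powers z) L) : N.mkQ v = 0 ↔ v ∈ N :=
    Submodule.Quotient.mk_eq_zero N
  refine PowRegular.of_ker_smul (z := z) f ?_ exists_pow_smul_locCoker_eq_zero ?_ ?_ ?_ ?_ hs
  · intro b
    obtain ⟨v, rfl⟩ := N.mkQ_surjective b
    exact ⟨N.mkQ (e.symm v), congr(N.mkQ $(e.apply_symm_apply v))⟩
  · intro α hα
    obtain ⟨β, hβ⟩ := (hN _).1 hα
    have hβ' : locMap z L β = e.symm (locMap z L α) := hβ
    have h0 : locMap z L (α - z • β) = 0 := by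
      rw [map_sub, map_smul, hβ', he, sub_self]
    obtain ⟨k, hk⟩ := locMap_eq_zero_iff.1 h0
    obtain ⟨m, hm⟩ := exists_pow_smul_eq_zero_of_ker hz k _ hk
    refine ⟨m, Submodule.mem_sup_right ⟨a ^ m • β, ?_⟩⟩
    rw [smul_sub, sub_eq_zero] at hm
    rw [LinearMap.lsmul_apply, smul_comm, hm]
  · intro α hα
    rw [bot_sup_eq] at hα
    obtain ⟨β, rfl⟩ := hα
    refine (hN (e.symm (locMap z L (z • β)))).2 ⟨β, ?_⟩
    rw [map_smul, he']
  · intro b hb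
    obtain ⟨v, rfl⟩ := N.mkQ_surjective b
    obtain ⟨l, hl⟩ := (hN (z • v)).1 hb
    refine ⟨l, ?_⟩
    rw [hf, hl, he']
    exact sub_self (N.mkQ v)
  · intro α
    exact (hN (z • e.symm (locMap z L α))).2 ⟨α, (he α).symm⟩

lemma powRegular_ofFn {a : R} {L : Type u} [AddCommGroup L] [Module R L] {n : ℕ} :
    ∀ (x : Fin n → R) (P : Submodule R L),
      (∀ i l, x i • l ∈ P ⊔ initialSubmodule L x i → ∃ m, a ^ m • l ∈ P ⊔ initialSubmodule L x i) →
      PowRegular a (List.ofFn x) P := by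
  induction n with
  | zero => exact fun x P _ => by simp [PowRegular]
  | succ n ih =>
    intro x P h
    rw [List.ofFn_succ]
    refine ⟨?_, ih _ _ fun i l hl => ?_⟩
    · have h0 : initialSubmodule L x 0 = ⊥ := by
        have : Set.Iio (0 : Fin (n + 1)) = ∅ := Set.Iio_bot
        simp [initialSubmodule, this]
      simpa [h0] using h 0
    · have hsucc : P ⊔ initialSubmodule L x i.succ =
          P ⊔ LinearMap.range (LinearMap.lsmul R L (x 0)) ⊔
            initialSubmodule L (fun i => x i.succ) i := by
        have himg : x '' Set.Iio i.succ = insert (x 0) ((fun i => x i.succ) '' Set.Iio i) := by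
          ext r
          simp only [Set.mem_image, Set.mem_Iio, Set.mem_insert_iff]
          constructor
          · rintro ⟨j, hj, rfl⟩
            cases j using Fin.cases with
            | zero => exact Or.inl rfl
            | succ j => exact Or.inr ⟨j, Fin.succ_lt_succ_iff.1 hj, rfl⟩
          · rintro (rfl | ⟨j, hj, rfl⟩)
            · exact ⟨0, Fin.succ_pos i, rfl⟩
            · exact ⟨j.succ, Fin.succ_lt_succ_iff.2 hj, rfl⟩
        have hr : Ideal.span {x 0} • (⊤ : Submodule R L) =
            LinearMap.range (LinearMap.lsmul R L (x 0)) := by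
          ext l
          simp [Submodule.ideal_span_singleton_smul,
            Submodule.mem_smul_pointwise_iff_exists]
        rw [initialSubmodule, himg, Ideal.span_insert, Submodule.sup_smul, hr, sup_assoc]
        rfl
      rw [← hsucc] at hl ⊢
      exact h i.succ l hl

/-- Every prime containing the annihilator of a class in the colon quotient lies in the support,
hence contains `a`; so `a` is in the radical of that annihilator. -/
lemma powRegular_of_isFilterRegularSeq {𝔞 : Ideal R} {L : Type u} [AddCommGroup L] [Module R L]
    {n : ℕ} {x : Fin n → R} (hx : IsFilterRegularSeq 𝔞 L x) {a : R} (ha : a ∈ 𝔞) :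
    PowRegular a (List.ofFn x) (⊥ : Submodule R L) := by
  refine powRegular_ofFn x ⊥ fun i l hl => ?_
  rw [bot_sup_eq] at hl ⊢
  let W := (initialSubmodule L x i).submoduleOf (colonElem (initialSubmodule L x i) (x i))
  let q := W.mkQ ⟨l, hl⟩
  have hrad : a ∈ (Submodule.span R {q}).annihilator.radical := by
    rw [Ideal.radical_eq_sInf]
    refine Submodule.mem_sInf.2 fun p ⟨hp, hprime⟩ => ?_
    exact hx.2 i (Module.mem_support_iff_exists_annihilator (p := ⟨p, hprime⟩).2 ⟨q, hp⟩) ha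
  obtain ⟨m, hm⟩ := hrad
  refine ⟨m, ?_⟩
  have h0 : W.mkQ (a ^ m • ⟨l, hl⟩) = 0 :=
    (Submodule.mem_annihilator_span_singleton q _).1 hm
  exact (Submodule.Quotient.mk_eq_zero W).1 h0

/-! ### Systems of quotients by powers of an ideal, and local cohomology as a limit. -/

/-- The data identifying the inverse system `D` with the system of the quotients `M / 𝔟ᵗM`. -/
structure PowQuotientSystem (𝔟 : Ideal R) (M : ModuleCat.{u} R) (D : ℕᵒᵖ ⥤ ModuleCat.{u} R) where
  /-- the projections -/
  π : (Functor.const ℕᵒᵖ).obj M ⟶ D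
  surjective : ∀ t, Function.Surjective (π.app t)
  ker_eq : ∀ t, LinearMap.ker (π.app t).hom = 𝔟 ^ unop t • ⊤

/-- The system `powQuotient 𝔟 M` consists of the quotients `M / 𝔟ᵗM`. -/
def powQuotientSystem (𝔟 : Ideal R) (M : ModuleCat.{u} R) :
    PowQuotientSystem 𝔟 M (powQuotient 𝔟 M) where
  π :=
    { app _ := ModuleCat.ofHom (Submodule.mkQ _)
      naturality _ _ _ := rfl }
  surjective _ := Submodule.mkQ_surjective _
  ker_eq _ := Submodule.ker_mkQ _

/-- The system of the quotients `R / 𝔟ᵗ` defining local cohomology. -/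
def ringModIdealsSystem (𝔟 : Ideal R) :
    PowQuotientSystem 𝔟 (ModuleCat.of R R)
      (localCohomology.ringModIdeals (localCohomology.idealPowersDiagram 𝔟)) where
  π :=
    { app _ := ModuleCat.ofHom (Submodule.mkQ _)
      naturality _ _ _ := rfl }
  surjective _ := Submodule.mkQ_surjective _
  ker_eq _ := (Submodule.ker_mkQ _).trans (Ideal.mul_top _).symm

/-- The value at `L` of the direct limit of the functors `Extᵖ(D t, -)`. -/
def colimitExtObjIso (D : ℕᵒᵖ ⥤ ModuleCat.{u} R) (p : ℕ) (L : ModuleCat.{u} R) :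
    (colimit (D.op ⋙ _root_.Ext R (ModuleCat.{u} R) p)).obj L ≅ limExt D p L :=
  colimitObjIsoColimitCompEvaluation _ L ≪≫
    HasColimit.isoOfNatIso (Functor.isoWhiskerLeft D.op (extIso p L))

/-- Generalized local cohomology in terms of the groups `Ext` of abelian categories. -/
def genLocalCohomologyObjIso (𝔟 : Ideal R) (M : ModuleCat.{u} R) (p : ℕ) (L : ModuleCat.{u} R) :
    (genLocalCohomology 𝔟 M p).obj L ≅ limExt (powQuotient 𝔟 M) p L :=
  colimitExtObjIso _ p L

/-- Local cohomology in terms of the groups `Ext` of abelian categories. -/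
def localCohomologyObjIso (𝔟 : Ideal R) (p : ℕ) (L : ModuleCat.{u} R) :
    (localCohomology 𝔟 p).obj L ≅
      limExt (localCohomology.ringModIdeals (localCohomology.idealPowersDiagram 𝔟)) p L :=
  colimitExtObjIso _ p L

/-- The radical of the annihilator of `l` contains the generators, hence `𝔟`; finite generation
turns this into a power of `𝔟` in the annihilator. -/
lemma exists_pow_le_annihilator {𝔟 : Ideal R} (hfg : 𝔟.FG) {s : Set R} (hs : Ideal.span s = 𝔟)
    {L : Type*} [AddCommGroup L] [Module R L] {l : L} (h : ∀ y ∈ s, ∃ m, y ^ m • l = 0) :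
    ∃ m, ∀ c ∈ 𝔟 ^ m, c • l = 0 := by
  have hrad : 𝔟 ≤ Ideal.radical (LinearMap.ker (LinearMap.toSpanSingleton R L l)) := by
    rw [← hs, Ideal.span_le]
    intro y hy
    obtain ⟨m, hm⟩ := h y hy
    exact ⟨m, hm⟩
  obtain ⟨m, hm⟩ := Ideal.exists_pow_le_of_le_radical_of_fg hrad hfg
  exact ⟨m, fun c hc => hm hc⟩

section System

variable {𝔟 : Ideal R} {M : ModuleCat.{u} R} {D : ℕᵒᵖ ⥤ ModuleCat.{u} R}
  (hD : PowQuotientSystem 𝔟 M D)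

include hD

lemma PowQuotientSystem.exists_pow_smul_eq_zero {y : R} (hy : y ∈ 𝔟) (t : ℕ) :
    ∃ k, ∀ x : D.obj (op t), y ^ k • x = 0 := by
  refine ⟨t, fun x => ?_⟩
  obtain ⟨m, rfl⟩ := hD.surjective (op t) x
  have h : y ^ t • m ∈ LinearMap.ker (hD.π.app (op t)).hom := by
    rw [hD.ker_eq]
    exact Submodule.smul_mem_smul (Ideal.pow_mem_pow hy t) trivial
  exact ((hD.π.app (op t)).hom.map_smul _ _).symm.trans h

lemma PowQuotientSystem.vanish [IsNoetherianRing R] [Module.Finite R M] {L : ModuleCat.{u} R}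
    (hL : ∀ l : L, ∃ m, ∀ c ∈ 𝔟 ^ m, c • l = 0) {p q : ℕ} (hM : HasProjectiveDimensionLT M p)
    (hpq : p ≤ q) : Vanish D q L :=
  have := hasProjectiveDimensionLT_of_ge M p q hpq
  vanish_of_torsion hD.π hD.surjective hD.ker_eq hL

end System

/-! ### Reduction of both sides to the iterated cokernel. -/

/-- The iterated cokernels of localization maps along a list of elements. -/
def iterLocCoker : List R → ModuleCat.{u} R → ModuleCat.{u} R
  | [], L => L
  | z :: zs, L => iterLocCoker zs (locCoker z L)

/-- If `zs` is regular on `N` up to powers of the elements of `𝔞` and `M` has projective dimension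
at most `i`, generalized local cohomology of degree `i + r` of `N` is that of degree `i` of the
iterated cokernel of `N` along `zs`, where `r` is the length of `zs`. -/
lemma nonempty_limExt_iso_iterLocCoker_of_powRegular [IsNoetherianRing R] {𝔞 : Ideal R}
    {M : ModuleCat.{u} R} [Module.Finite R M] {D : ℕᵒᵖ ⥤ ModuleCat.{u} R}
    (hD : PowQuotientSystem 𝔞 M D) {i : ℕ} (hM : HasProjectiveDimensionLT M (i + 1))
    {zs : List R} : ∀ (L : ModuleCat.{u} R), (∀ z ∈ zs, z ∈ 𝔞) →
      (∀ a ∈ 𝔞, PowRegular a zs (⊥ : Submodule R L)) →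
      Nonempty (limExt D (i + zs.length) L ≅ limExt D i (iterLocCoker zs L)) := by
  induction zs with
  | nil => exact fun L _ _ => ⟨Iso.refl _⟩
  | cons z zs ih =>
    intro L hzs hL
    obtain ⟨e⟩ := ih (locCoker z L) (fun w hw => hzs w (List.mem_cons_of_mem _ hw))
      fun a ha => powRegular_locCoker (hL a ha)
    have htors (l : powTorsion z L) : ∃ m, ∀ c ∈ 𝔞 ^ m, c • l = 0 := by
      refine exists_pow_le_annihilator (IsNoetherian.noetherian 𝔞) (Ideal.span_eq 𝔞) fun a ha => ?_
      obtain ⟨k, hk⟩ := mem_ker_toLocRange.1 l.2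
      obtain ⟨m, hm⟩ := exists_pow_smul_eq_zero_of_ker (hL a ha).1 k _ hk
      exact ⟨m, Subtype.ext hm⟩
    -- The torsion must vanish in degrees `i + zs.length + 1` and `i + zs.length + 2`, both above
    -- the projective dimension bound `i`.
    obtain ⟨e'⟩ := nonempty_limExt_iso_locCoker L
      (hD.exists_pow_smul_eq_zero (hzs z List.mem_cons_self)) (p := i + zs.length)
      (hD.vanish htors hM (by lia)) (hD.vanish htors hM (by lia))
    exact ⟨e' ≪≫ e⟩

/-- Precomposition with `R → D t` embeds each stage in `Hom(R, L) = L`; every map `R → L` kills a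
power of `𝔟` and so factors through some stage. -/
lemma PowQuotientSystem.nonempty_limExt_zero_iso {𝔟 : Ideal R} {D : ℕᵒᵖ ⥤ ModuleCat.{u} R}
    (hD : PowQuotientSystem 𝔟 (ModuleCat.of R R) D) {L : ModuleCat.{u} R}
    (hL : ∀ l : L, ∃ m, ∀ c ∈ 𝔟 ^ m, c • l = 0) : Nonempty (limExt D 0 L ≅ L) := by
  have := preservesSmallestFilteredColimits_of_preservesFilteredColimits
    (forget (ModuleCat.{u} R))
  let c : Cocone (D.op ⋙ extLeft R 0 L) :=
    { pt := ModuleCat.of R (Ext (ModuleCat.of R R) L 0)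
      ι :=
        { app t := ModuleCat.ofHom
            ((Ext.mk₀ (hD.π.app t.unop)).precompOfLinear R L (zero_add 0))
          naturality t t' f := by
            ext ξ
            refine (Ext.mk₀_comp_mk₀_assoc (hD.π.app t'.unop) (D.map f.unop) ξ).trans ?_
            rw [← hD.π.naturality f.unop]
            exact congr((Ext.mk₀ $(Category.id_comp _)).comp ξ (zero_add 0)) } }
  have hι (t) (ξ : (D.op ⋙ extLeft R 0 L).obj t) :
      colimit.desc _ c (colimit.ι (D.op ⋙ extLeft R 0 L) t ξ) = c.ι.app t ξ :=
    congr($(colimit.ι_desc c t) ξ)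
  have hbij : Function.Bijective (colimit.desc _ c) := by
    constructor
    · rw [injective_iff_map_eq_zero]
      intro x hx
      obtain ⟨t, ξ, rfl⟩ := Concrete.colimit_exists_rep _ x
      rw [hι] at hx
      have : Epi (hD.π.app t.unop) := (ModuleCat.epi_iff_surjective _).2 (hD.surjective _)
      have h0 : ξ = 0 := Ext.precomp_mk₀_injective_of_epi L (hD.π.app t.unop)
        (hx.trans (Ext.comp_zero (Ext.mk₀ (hD.π.app t.unop)) L 0 0 (zero_add 0)).symm)
      rw [h0, map_zero]
    · intro e
      obtain ⟨φ, rfl⟩ := (Ext.mk₀_bijective (ModuleCat.of R R) L).surjective e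
      obtain ⟨t, ht⟩ := exists_pow_smul_eq_zero_of_finite hL φ.hom
      have hker : LinearMap.ker (hD.π.app (op t)).hom ≤ LinearMap.ker φ.hom := by
        rw [hD.ker_eq]
        exact ht
      let ψ : D.obj (op t) ⟶ L := ModuleCat.ofHom (Submodule.liftQ _ φ.hom hker ∘ₗ
        ((hD.π.app (op t)).hom.quotKerEquivOfSurjective (hD.surjective _)).symm.toLinearMap)
      have hψ : hD.π.app (op t) ≫ ψ = φ := by
        refine ModuleCat.hom_ext (LinearMap.ext fun r => ?_)
        exact congr(Submodule.liftQ _ φ.hom hker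
          $(LinearMap.quotKerEquivOfSurjective_symm_apply _ (hD.surjective (op t)) r))
      refine ⟨colimit.ι (D.op ⋙ extLeft R 0 L) (op (op t)) (Ext.mk₀ ψ), ?_⟩
      exact ((hι _ _).trans (Ext.mk₀_comp_mk₀ _ _)).trans congr(Ext.mk₀ $hψ)
  have hiso : IsIso (colimit.desc _ c) := (ConcreteCategory.isIso_iff_bijective _).2 hbij
  exact ⟨@asIso _ _ _ _ _ hiso ≪≫
    ((Ext.linearEquiv₀ (R := R)).trans ((ModuleCat.homLinearEquiv (S := R)).trans
      (LinearMap.ringLmapEquivSelf R R L))).toModuleIso⟩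

section LocalCohomology

variable [IsNoetherianRing R] {𝔟 : Ideal R} {D : ℕᵒᵖ ⥤ ModuleCat.{u} R}
  (hD : PowQuotientSystem 𝔟 (ModuleCat.of R R) D) {s : Set R} (hs : Ideal.span s = 𝔟)

include hD hs

/-- Local cohomology with respect to `𝔟` vanishes above degree `r` on modules which are torsion with
respect to all but `r` of the given generators of `𝔟`. -/
lemma vanish_of_length_lt {zs : List R} :
    ∀ (L : ModuleCat.{u} R), (∀ z ∈ zs, z ∈ 𝔟) →
      (∀ y ∈ s, y ∈ zs ∨ ∀ l : L, ∃ m, y ^ m • l = 0) →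
      ∀ p, zs.length < p → Vanish D p L := by
  induction zs with
  | nil =>
    intro L _ hL p hp
    -- All generators now act with torsion, and `R` is projective, so every positive degree
    -- vanishes.
    refine hD.vanish (fun l => ?_) (p := 1) inferInstance hp
    exact exists_pow_le_annihilator (IsNoetherian.noetherian 𝔟) hs fun y hy =>
      (hL y hy).resolve_left List.not_mem_nil l
  | cons z zs ih =>
    intro L hzs hL p hp
    obtain ⟨p, rfl⟩ : ∃ q, p = q + 1 := ⟨p - 1, by lia⟩
    have hzs' : ∀ w ∈ zs, w ∈ 𝔟 := fun w hw => hzs w (List.mem_cons_of_mem _ hw)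
    simp only [List.length_cons, Nat.add_lt_add_iff_right] at hp
    -- Both the torsion and the cokernel are `z`-power torsion and inherit torsion for the other
    -- generators, so `z` leaves the list in either case.
    refine vanish_of_vanish_locCoker L (hD.exists_pow_smul_eq_zero (hzs z List.mem_cons_self))
      (ih _ hzs' (fun y hy => ?_) _ (by lia)) (ih _ hzs' (fun y hy => ?_) _ hp)
    · rcases hL y hy with h | h
      · rcases List.mem_cons.1 h with rfl | h
        · exact Or.inr exists_pow_smul_powTorsion_eq_zero
        · exact Or.inl h
      · exact Or.inr (exists_pow_smul_powTorsion_eq_zero_of_forall h)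
    · rcases hL y hy with h | h
      · rcases List.mem_cons.1 h with rfl | h
        · exact Or.inr exists_pow_smul_locCoker_eq_zero
        · exact Or.inl h
      · exact Or.inr (exists_pow_smul_locCoker_eq_zero_of_forall h)

/-- The top local cohomology with respect to generators `zs` is the iterated cokernel along `zs`. -/
lemma nonempty_limExt_iso_iterLocCoker {zs : List R} :
    ∀ (L : ModuleCat.{u} R), (∀ z ∈ zs, z ∈ 𝔟) →
      (∀ y ∈ s, y ∈ zs ∨ ∀ l : L, ∃ m, y ^ m • l = 0) →
      Nonempty (limExt D zs.length L ≅ iterLocCoker zs L) := by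
  induction zs with
  | nil =>
    intro L _ hL
    exact hD.nonempty_limExt_zero_iso fun l =>
      exists_pow_le_annihilator (IsNoetherian.noetherian 𝔟) hs fun y hy =>
        (hL y hy).resolve_left List.not_mem_nil l
  | cons z zs ih =>
    intro L hzs hL
    have hzs' : ∀ w ∈ zs, w ∈ 𝔟 := fun w hw => hzs w (List.mem_cons_of_mem _ hw)
    have hL₁ : ∀ y ∈ s, y ∈ zs ∨ ∀ l : powTorsion z L, ∃ m, y ^ m • l = 0 := fun y hy => by
      rcases hL y hy with h | h
      · rcases List.mem_cons.1 h with rfl | h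
        · exact Or.inr exists_pow_smul_powTorsion_eq_zero
        · exact Or.inl h
      · exact Or.inr (exists_pow_smul_powTorsion_eq_zero_of_forall h)
    have hL₂ : ∀ y ∈ s, y ∈ zs ∨ ∀ l : locCoker z L, ∃ m, y ^ m • l = 0 := fun y hy => by
      rcases hL y hy with h | h
      · rcases List.mem_cons.1 h with rfl | h
        · exact Or.inr exists_pow_smul_locCoker_eq_zero
        · exact Or.inl h
      · exact Or.inr (exists_pow_smul_locCoker_eq_zero_of_forall h)
    obtain ⟨e⟩ := nonempty_limExt_iso_locCoker L
      (hD.exists_pow_smul_eq_zero (hzs z List.mem_cons_self)) (p := zs.length)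
      (vanish_of_length_lt hD hs _ hzs' hL₁ _ (by lia))
      (vanish_of_length_lt hD hs _ hzs' hL₁ _ (by lia))
    obtain ⟨e'⟩ := ih _ hzs' hL₂
    exact ⟨e ≪≫ e'⟩

end LocalCohomology

end LimExt

end

open LimExt in
theorem lemma2p8 {R : Type u} [CommRing R] [IsNoetherianRing R] (𝔞 : Ideal R)
    (M : ModuleCat.{u} R) [Module.Finite R M] (hM : projectiveDimension M ≠ ⊤)
    (N : ModuleCat.{u} R) (n : ℕ) (x : Fin n → R) (hx : IsFilterRegularSeq 𝔞 N x)
    (i : ℕ) (hi : projectiveDimension M ≤ (i : WithBot ℕ∞)) :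
    Nonempty ((genLocalCohomology 𝔞 M (i + n)).obj N ≅
      (genLocalCohomology 𝔞 M i).obj
        ((localCohomology (Ideal.span (Set.range x)) n).obj N)) := by
  have hpd : HasProjectiveDimensionLT M (i + 1) := (projectiveDimension_le_iff M i).1 hi
  obtain ⟨e₁⟩ := nonempty_limExt_iso_iterLocCoker_of_powRegular (powQuotientSystem 𝔞 M) hpd N
    (zs := List.ofFn x) (fun z hz => by
      obtain ⟨j, rfl⟩ := (List.mem_ofFn' x z).1 hz
      exact hx.1 j)
    fun a ha => powRegular_of_isFilterRegularSeq hx ha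
  -- All generators are in the list, so nothing is asked of `N`. The list is the same as for `e₁`,
  -- so both isomorphisms involve the same iterated cokernel.
  obtain ⟨e₂⟩ := nonempty_limExt_iso_iterLocCoker (ringModIdealsSystem (Ideal.span (Set.range x)))
    rfl N (zs := List.ofFn x) (fun z hz => Ideal.subset_span ((List.mem_ofFn' x z).1 hz))
    fun y hy => Or.inl ((List.mem_ofFn' x y).2 hy)
  rw [List.length_ofFn] at e₁ e₂
  exact ⟨genLocalCohomologyObjIso 𝔞 M (i + n) N ≪≫ e₁ ≪≫
    (genLocalCohomologyObjIso 𝔞 M i _).symm ≪≫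
    (genLocalCohomology 𝔞 M i).mapIso ((localCohomologyObjIso _ n N ≪≫ e₂).symm)⟩
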